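/- **Setting.** Let $H$ be a hypergraph with $n$ vertices (set $V$) and $n$ hyperedges, each containing exactly $\delta$ vertices, such that no hyperedge intersects more than $d$ other hyperedges. Let $0<\alpha<1/2$ and assume $2e(d+1)\le 2^{\alpha\delta}$. The intersection graph of $H$ has the hyperedges as nodes, two distinct hyperedges being adjacent iff they share a vertex. Let $u>2$ be an integer and let $C_1,\dots,C_x$ be arbitrary red/blue colorings of $V$. **Algorithm LocalHypColoring.** At the start no vertex has a fixed color; fixed (decided) colors never change. At any time, a hyperedge is *non-idle* if its vertices with fixed colors do not include both colors and at least one of its vertices is undecided; otherwise it is *idle*. Phase $i$ ($1\le i\le x$) works as follows. A set $P_i$ of hyperedges takes part, which contains all hyperedges that are non-idle at the beginning of the phase (it does not matter which idle hyperedges are still classified). Every undecided vertex $v$ temporarily takes the color $C_i(v)$. Counting fixed and temporary colors, a hyperedge of $P_i$ is *biased* if at most $\alpha\delta$ of its vertices are red or at most $\alpha\delta$ of its vertices are blue. A vertex is *bad* if it belongs to a biased hyperedge, and *good* otherwise. A hyperedge of $P_i$ is *dangerous* if it contains at least $\alpha\delta$ bad vertices. A set $T$ of hyperedges is a *connected $1,2$-component*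 if any two members of $T$ are joined by a path in the intersection graph on which, of any two consecutive hyperedges, at least one belongs to $T$. Then: 1. every undecided good vertex $v$ fixes the color $C_i(v)$; 2. for each maximal connected $1,2$-component $T$ of biased hyperedges in which any two hyperedges have distance less than $3u$ in the intersection graph, the undecided bad vertices in hyperedges of $T$ fix the colors computed by a deterministic procedure (Black-Box) applied to $T$ together with the dangerous non-biased hyperedges that intersect members of $T$. Black-Box keeps all colors fixed so far, and its output makes all these hyperedges bi-chromatic whenever that is possible at all; 3. finally, every vertex that is still undecided and all of whose hyperedges already contain both a fixed red and a fixed blue vertex fixes the color $C_i(v)$. **Lemma.** In every execution of the algorithm, and for every $0\le i\le x$, where "at the end of phase $0$" means initially: - each hyperedge $f$ that is non-idle at the end of phase $i$ satisfies: (a) all vertices of $f$ with fixed colors have the same color, and (b) at least $\alpha\delta$ vertices of $f$ are undecided; - each hyperedge that is idle at the end of phase $i$ stays idle and is bi-chromatic, i.e. contains both a vertex with fixed color red and a vertex with fixed color blue, at the end of every phase $j$ with $i\le j\le x$. -/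

import Mathlib

namespace LocalHyp

/-- A hypergraph with vertices `V` and hyperedges (units) `U`; `verts w` is the neighbourhood
`N(w)`, that is, the vertex set of the hyperedge `w`. -/
structure Hypergraph (V U : Type*) where
  verts : U → Finset V

/-- Two colors: `true` is red and `false` is blue. -/
abbrev Color := Bool

/-- The fixed (decided) colors: `none` means that the vertex is undecided. -/
abbrev PartialColoring (V : Type*) := V → Option Color

section

variable {V U : Type*}

/-- `n` vertices and `n` hyperedges, each of which contains exactly `δ` vertices. -/
def Hypergraph.Admissible [Fintype V] [Fintype U] (H : Hypergraph V U) (n δ : ℕ) : Prop :=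
  Fintype.card V = n ∧ Fintype.card U = n ∧ ∀ e, (H.verts e).card = δ

/-- The intersection graph `G(H)`. -/
def Hypergraph.intersectionGraph (H : Hypergraph V U) : SimpleGraph U where
  Adj e f := e ≠ f ∧ ∃ v, v ∈ H.verts e ∧ v ∈ H.verts f
  symm := ⟨fun _ _ h => ⟨h.1.symm, h.2.imp fun _ hv => hv.symm⟩⟩
  loopless := ⟨fun _ h => h.1 rfl⟩

/-- No hyperedge intersects more than `d` other hyperedges. -/
def Hypergraph.IntersectsAtMost (H : Hypergraph V U) (d : ℕ) : Prop :=
  ∀ e, {f | H.intersectionGraph.Adj e f}.encard ≤ d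

/-- The fixed colors inside `e` are all the same (possibly no color is fixed). -/
def Hypergraph.FixedMonochromatic (H : Hypergraph V U) (s : PartialColoring V) (e : U) : Prop :=
  ∃ a : Color, ∀ v ∈ H.verts e, ∀ b, s v = some b → b = a

/-- The hyperedge `e` has a vertex with fixed color red and one with fixed color blue. -/
def Hypergraph.FixedBichromatic (H : Hypergraph V U) (s : PartialColoring V) (e : U) : Prop :=
  (∃ v ∈ H.verts e, s v = some true) ∧ ∃ v ∈ H.verts e, s v = some false

open Classical in
/-- The undecided vertices of the hyperedge `e`. -/
noncomputable def Hypergraph.undecided (H : Hypergraph V U) (s : PartialColoring V) (e : U) :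
    Finset V :=
  (H.verts e).filter fun v => s v = none

/-- A hyperedge is non-idle if its fixed-color part is monochromatic and some of its vertices
are still undecided. -/
def Hypergraph.NonIdle (H : Hypergraph V U) (s : PartialColoring V) (e : U) : Prop :=
  H.FixedMonochromatic s e ∧ ∃ v ∈ H.verts e, s v = none

/-- The coloring used in a phase: fixed colors where they exist, otherwise temporary colors. -/
def currentColor (s : PartialColoring V) (C : V → Color) (v : V) : Color :=
  (s v).getD (C v)

open Classical in
/-- At most `α δ` vertices of `e` are red or at most `α δ` vertices of `e` are blue. -/
def Hypergraph.Biased (H : Hypergraph V U) (α : ℝ) (δ : ℕ) (c : V → Color) (e : U) : Prop :=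
  ∃ a : Color, (((H.verts e).filter fun v => c v = a).card : ℝ) ≤ α * δ

/-- The set of vertices that belong to some hyperedge of `B`. -/
def Hypergraph.covered (H : Hypergraph V U) (B : Set U) : Set V :=
  {v | ∃ e ∈ B, v ∈ H.verts e}

open Classical in
/-- At least `α δ` vertices of `e` are bad, i.e. belong to a hyperedge of `B`, the set of biased
hyperedges. -/
def Hypergraph.Dangerous (H : Hypergraph V U) (α : ℝ) (δ : ℕ) (B : Set U) (e : U) : Prop :=
  α * δ ≤ (((H.verts e).filter fun v => v ∈ H.covered B).card : ℝ)

/-- `T` is a connected `1,2`-component: any two hyperedges of `T` are joined by a path in the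
intersection graph such that among any two consecutive hyperedges at least one is in `T`. -/
def Hypergraph.Connected12 (H : Hypergraph V U) (T : Set U) : Prop :=
  ∀ x ∈ T, ∀ y ∈ T, ∃ p : H.intersectionGraph.Walk x y,
    p.IsPath ∧ ∀ a ∈ p.darts, a.fst ∈ T ∨ a.snd ∈ T

/-- `T` is a maximal connected `1,2`-component of hyperedges from `B`. -/
def Hypergraph.IsComponent12 (H : Hypergraph V U) (B T : Set U) : Prop :=
  Maximal (fun S : Set U => S.Nonempty ∧ S ⊆ B ∧ H.Connected12 S) T

/-- Any two hyperedges of `T` are at distance smaller than `3u` in the intersection graph. -/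
def Hypergraph.SmallDiameter (H : Hypergraph V U) (u : ℕ) (T : Set U) : Prop :=
  ∀ x ∈ T, ∀ y ∈ T, H.intersectionGraph.edist x y < ((3 * u : ℕ) : ℕ∞)

/-- The full coloring `c` keeps the colors fixed by `g` and makes every hyperedge in `F`
bi-chromatic. -/
def Hypergraph.Solves (H : Hypergraph V U) (g : PartialColoring V) (F : Set U) (c : V → Color) :
    Prop :=
  (∀ v a, g v = some a → c v = a) ∧
    ∀ e ∈ F, (∃ v ∈ H.verts e, c v = true) ∧ ∃ v ∈ H.verts e, c v = false

/-- A (deterministic, sequential) bi-chromatic coloring procedure: from a hypergraph, the colors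
that must be kept, and the hyperedges that are to become bi-chromatic, it computes colors. -/
abbrev BlackBox (V U : Type*) := Hypergraph V U → PartialColoring V → Set U → V → Color

/-- The procedure outputs a solution for every input that has one. -/
def BlackBox.Correct (bb : BlackBox V U) : Prop :=
  ∀ (H : Hypergraph V U) (g : PartialColoring V) (F : Set U), (∃ c, H.Solves g F c) → H.Solves g F (bb H g F)

/-- The biased ones among the hyperedges `P` that take part in the phase. -/
def Hypergraph.biasedSet (H : Hypergraph V U) (α : ℝ) (δ : ℕ) (P : Set U)
    (s : PartialColoring V) (C : V → Color) : Set U :=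
  {e | e ∈ P ∧ H.Biased α δ (currentColor s C) e}

/-- The component `T` together with the dangerous non-biased hyperedges that intersect it. -/
def Hypergraph.withDangerous (H : Hypergraph V U) (α : ℝ) (δ : ℕ) (P B T : Set U) : Set U :=
  T ∪ {e | e ∈ P ∧ e ∉ B ∧ H.Dangerous α δ B e ∧ ∃ f ∈ T, H.intersectionGraph.Adj e f}

open Classical in
/-- Every undecided good vertex (outside of all biased hyperedges) fixes its temporary color. -/
noncomputable def Hypergraph.fixGood (H : Hypergraph V U) (B : Set U) (C : V → Color)
    (s : PartialColoring V) : PartialColoring V := fun v =>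
  if s v = none ∧ v ∉ H.covered B then some (C v) else s v

open Classical in
/-- Every undecided bad vertex that is covered by a maximal connected `1,2`-component `T` of biased
hyperedges of small diameter fixes the color that the black box computes for `T` together with
the adjacent dangerous non-biased hyperedges. (A vertex is covered by at most one such `T`.) -/
noncomputable def Hypergraph.recolor (H : Hypergraph V U) (α : ℝ) (δ u : ℕ) (bb : BlackBox V U)
    (P B : Set U) (g : PartialColoring V) : PartialColoring V := fun v =>
  if h : g v = none ∧ ∃ T, H.IsComponent12 B T ∧ H.SmallDiameter u T ∧ v ∈ H.covered T then
    some (bb H g (H.withDangerous α δ P B h.2.choose) v)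
  else g v

open Classical in
/-- Every undecided vertex all of whose hyperedges have bi-chromatic fixed-color vertices fixes
its temporary color. -/
noncomputable def Hypergraph.fixFinished (H : Hypergraph V U) (C : V → Color)
    (m : PartialColoring V) : PartialColoring V := fun v =>
  if m v = none ∧ ∀ e, v ∈ H.verts e → H.FixedBichromatic m e then some (C v) else m v

/-- One phase: `s` are the fixed colors at its beginning, `C` is the coloring of the phase, and
`P` are the hyperedges that take part in it. The value is the fixed colors at its end. -/
noncomputable def Hypergraph.phase (H : Hypergraph V U) (α : ℝ) (δ u : ℕ) (bb : BlackBox V U)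
    (C : V → Color) (P : Set U) (s : PartialColoring V) : PartialColoring V :=
  let B := H.biasedSet α δ P s C
  H.fixFinished C (H.recolor α δ u bb P B (H.fixGood B C s))

/-- `S i`, for `i ≤ x`, are the fixed colors at the end of phase `i` of an execution of algorithm
LocalHypColoring with colorings `C 1, …, C x` (and `S 0` is the initial situation). All non-idle
hyperedges take part in a phase; it is left open which idle ones are still classified. -/
structure Hypergraph.IsExecution (H : Hypergraph V U) (α : ℝ) (δ u : ℕ) (bb : BlackBox V U)
    (x : ℕ) (C : ℕ → V → Color) (S : ℕ → PartialColoring V) : Prop where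
  init : ∀ v, S 0 v = none
  step : ∀ i < x, ∃ P : Set U, {e | H.NonIdle (S i) e} ⊆ P ∧
    S (i + 1) = H.phase α δ u bb (C (i + 1)) P (S i)

end

end LocalHyp

/-! The invariant is `Safe`: every hyperedge has both fixed colors or at least αδ undecided
vertices. Since αδ > 0, a hyperedge without both fixed colors is then non-idle, so idle means
bi-chromatic, and fixed colors never change. Each step of a phase keeps the invariant. Fixing good
vertices leaves biased hyperedges untouched, and a non-biased one that stays monochromatic keeps
more than αδ undecided vertices of the other current color. In the recoloring step, a hyperedge not
yet bi-chromatic has at least αδ undecided, hence bad, vertices, so it is biased or dangerous. All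
these vertices lie in one 1,2-component, so the Black-Box recolors all of them or none. Its instance
is solvable by the Lovász local lemma: a uniform coloring of the undecided vertices makes a
hyperedge monochromatic with probability at most 2·2^(-αδ) ≤ 1/(e(d+1)). The final step touches only
vertices of bi-chromatic hyperedges. -/

namespace LocalHyp

/-! ### The Lovász local lemma, by counting -/

open Finset in
/-- Events on independent uniform coordinates that depend on disjoint sets of coordinates are
independent. -/
theorem card_inter_mul_card_fun {V κ : Type*} [Fintype V] [DecidableEq V] [Fintype κ]
    [DecidableEq κ] (N : Finset V) (A B : Finset (V → κ))
    (hA : ∀ c c' : V → κ, (∀ v ∈ N, c v = c' v) → c ∈ A → c' ∈ A)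
    (hB : ∀ c c' : V → κ, (∀ v ∉ N, c v = c' v) → c ∈ B → c' ∈ B) :
    #(A ∩ B) * Fintype.card (V → κ) = #A * #B := by
  rw [← Finset.card_univ, ← Finset.card_product, ← Finset.card_product]
  -- Exchanging the coordinates outside `N` is an involution on pairs that matches `(A ∩ B) × univ`
  -- with `A × B`.
  let φ : (V → κ) × (V → κ) → (V → κ) × (V → κ) := fun q =>
    (fun v => if v ∈ N then q.1 v else q.2 v, fun v => if v ∈ N then q.2 v else q.1 v)
  have hφ : ∀ q, φ (φ q) = q := by
    intro q
    ext v <;> by_cases hv : v ∈ N <;> simp [φ, hv]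
  refine Finset.card_bij' (fun q _ => φ q) (fun q _ => φ q) ?_ ?_
    (fun q _ => hφ q) (fun q _ => hφ q)
  · intro q hq
    simp only [mem_product, mem_inter, mem_univ, and_true] at hq ⊢
    exact ⟨hA _ _ (fun v hv => by simp [φ, hv]) hq.1, hB _ _ (fun v hv => by simp [φ, hv]) hq.2⟩
  · intro q hq
    simp only [mem_product, mem_inter, mem_univ, and_true] at hq ⊢
    exact ⟨hA _ _ (fun v hv => by simp [φ, hv]) hq.1, hB _ _ (fun v hv => by simp [φ, hv]) hq.2⟩

open Finset in
/-- The assignments that avoid all events indexed by `S`. -/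
def avoiding {V U κ : Type*} [Fintype V] [DecidableEq V] [Fintype κ] [DecidableEq κ]
    (A : U → Finset (V → κ)) (S : Finset U) : Finset (V → κ) :=
  univ.filter fun c => ∀ f ∈ S, c ∉ A f

section LocalLemma

variable {V U κ : Type*} [Fintype V] [DecidableEq V] [DecidableEq U] [Fintype κ] [DecidableEq κ]

open Finset

theorem card_avoiding_insert (A : U → Finset (V → κ)) (S : Finset U) (e : U) :
    (#(avoiding A (insert e S)) : ℝ) = #(avoiding A S) - #(A e ∩ avoiding A S) := by
  have h1 : avoiding A (insert e S) = avoiding A S \ (A e ∩ avoiding A S) := by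
    ext c
    simp only [avoiding, mem_filter, mem_univ, true_and, mem_insert, forall_eq_or_imp, mem_sdiff,
      mem_inter]
    tauto
  rw [h1, cast_card_sdiff inter_subset_right]

/-- Chain rule: adding the events of `T` one at a time costs a factor of at least `1 - x` each. Only
proper subsets `T'` occur in `h`, so that a strong induction can supply it. -/
theorem pow_mul_card_avoiding_le (A : U → Finset (V → κ)) {x : ℝ} (hx1 : x ≤ 1)
    (S T : Finset U)
    (h : ∀ T' ⊂ T, ∀ e ∈ T, e ∉ S ∪ T' →
      (#(A e ∩ avoiding A (S ∪ T')) : ℝ) ≤ x * #(avoiding A (S ∪ T')))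
    (hST : Disjoint S T) :
    (1 - x) ^ #T * (#(avoiding A S) : ℝ) ≤ #(avoiding A (S ∪ T)) := by
  induction T using Finset.induction_on with
  | empty => simp
  | insert e T he ih =>
    have hST' := hST
    rw [disjoint_insert_right] at hST'
    have heST : e ∉ S ∪ T := by simp [he, hST'.1]
    have h1 := ih (fun T' hT' f hf => h T' (hT'.trans (ssubset_insert he)) f
      (mem_insert_of_mem hf)) hST'.2
    have h2 := h T (ssubset_insert he) e (mem_insert_self _ _) heST
    rw [union_insert, card_avoiding_insert, card_insert_of_notMem he, pow_succ]
    nlinarith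

/-- The inductive bound behind the Lovász local lemma. -/
theorem card_inter_avoiding_le (N : U → Finset V) (A : U → Finset (V → κ))
    (hA : ∀ e, ∀ c c' : V → κ, (∀ v ∈ N e, c v = c' v) → c ∈ A e → c' ∈ A e)
    {x : ℝ} (hx0 : 0 ≤ x) (hx1 : x ≤ 1) [Nonempty κ] (d : ℕ)
    (hd : ∀ e, ∀ S : Finset U, (∀ f ∈ S, f ≠ e ∧ ¬ Disjoint (N e) (N f)) → #S ≤ d)
    (hp : ∀ e, (#(A e) : ℝ) ≤ x * (1 - x) ^ d * Fintype.card (V → κ))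
    (S : Finset U) (e : U) (he : e ∉ S) :
    (#(A e ∩ avoiding A S) : ℝ) ≤ x * #(avoiding A S) := by
  induction S using Finset.strongInduction generalizing e with
  | H S ih =>
    -- The events in `S₂` are independent of `A e`; the at most `d` events in `S₁` are paid for by
    -- the factor `(1 - x) ^ d`.
    set S₁ := S.filter fun f => ¬ Disjoint (N e) (N f) with hS₁
    set S₂ := S.filter fun f => Disjoint (N e) (N f) with hS₂
    have hS : S₂ ∪ S₁ = S := filter_union_filter_not_eq _ _
    have hdis : Disjoint S₂ S₁ := disjoint_filter_filter_not _ _ _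
    have hcard : #S₁ ≤ d := by
      refine hd e S₁ fun f hf => ?_
      rw [hS₁, mem_filter] at hf
      exact ⟨fun h => he (h ▸ hf.1), hf.2⟩
    have h1 := pow_mul_card_avoiding_le A hx1 S₂ S₁ (fun T' hT' f _ hf' => by
      refine ih _ ?_ f hf'
      rw [← hS]
      refine (union_subset_union_right hT'.subset).ssubset_of_ne fun heq => ?_
      obtain ⟨y, hy, hy'⟩ := exists_of_ssubset hT'
      have : y ∈ S₂ ∪ T' := heq ▸ mem_union_right _ hy
      rcases mem_union.1 this with h | h
      · exact (disjoint_left.1 hdis h hy)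
      · exact hy' h) hdis
    rw [hS] at h1
    have h2 := card_inter_mul_card_fun (N e) (A e) (avoiding A S₂) (hA e) (by
      intro c c' hcc hc
      simp only [avoiding, mem_filter, mem_univ, true_and] at hc ⊢
      intro f hf hf'
      refine hc f hf (hA f c' c (fun v hv => (hcc v fun hv' => ?_).symm) hf')
      rw [hS₂, mem_filter] at hf
      exact disjoint_left.1 hf.2 hv' hv)
    have h2' : (#(A e ∩ avoiding A S₂) : ℝ) * Fintype.card (V → κ) =
        #(A e) * #(avoiding A S₂) := by exact_mod_cast h2
    have hpos : (0 : ℝ) < Fintype.card (V → κ) := by exact_mod_cast Fintype.card_pos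
    have h3 : (#(A e ∩ avoiding A S₂) : ℝ) ≤ x * (1 - x) ^ d * #(avoiding A S₂) := by
      refine le_of_mul_le_mul_right ?_ hpos
      rw [h2']
      have := mul_le_mul_of_nonneg_right (hp e) (Nat.cast_nonneg (α := ℝ) #(avoiding A S₂))
      linarith
    have h4 : (#(A e ∩ avoiding A S) : ℝ) ≤ #(A e ∩ avoiding A S₂) := by
      have : A e ∩ avoiding A S ⊆ A e ∩ avoiding A S₂ := by
        refine inter_subset_inter_left fun c hc => ?_
        simp only [avoiding, mem_filter, mem_univ, true_and] at hc ⊢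
        exact fun f hf => hc f (hS ▸ mem_union_left _ hf)
      exact_mod_cast card_le_card this
    have h5 : (1 - x) ^ d * (#(avoiding A S₂) : ℝ) ≤ #(avoiding A S) :=
      (mul_le_mul_of_nonneg_right
        (pow_le_pow_of_le_one (by linarith) (by linarith) hcard) (Nat.cast_nonneg _)).trans h1
    calc _ ≤ _ := h4
      _ ≤ _ := h3
      _ = x * ((1 - x) ^ d * #(avoiding A S₂)) := by ring
      _ ≤ _ := mul_le_mul_of_nonneg_left h5 hx0

/-- The symmetric Lovász local lemma for events on independent uniform coordinates. -/
theorem exists_forall_notMem_of_local [Fintype U] [Nonempty κ] (N : U → Finset V)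
    (A : U → Finset (V → κ))
    (hA : ∀ e, ∀ c c' : V → κ, (∀ v ∈ N e, c v = c' v) → c ∈ A e → c' ∈ A e)
    (d : ℕ)
    (hd : ∀ e, ∀ S : Finset U, (∀ f ∈ S, f ≠ e ∧ ¬ Disjoint (N e) (N f)) → #S ≤ d)
    (hp : ∀ e, Real.exp 1 * (d + 1) * #(A e) ≤ Fintype.card (V → κ)) :
    ∃ c, ∀ e, c ∉ A e := by
  -- With 1/(d+1) instead, `1 - x` would vanish for `d = 0`. Here x(1-x)^d =
  -- ((d+1)/(d+2))^(d+1)/(d+1) ≥ 1/(e(d+1)).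
  set x : ℝ := 1 / (d + 2) with hx
  have hd2 : (0 : ℝ) < d + 2 := by positivity
  have hd1 : (0 : ℝ) < d + 1 := by positivity
  have hx0 : 0 ≤ x := by positivity
  have hx1 : x < 1 := by rw [hx, div_lt_one hd2]; linarith [Nat.cast_nonneg (α := ℝ) d]
  have hx' : 1 - x = (d + 1) / (d + 2) := by rw [hx]; field_simp; ring
  have hexp : 1 ≤ Real.exp 1 * ((d + 1) / (d + 2) : ℝ) ^ (d + 1) := by
    have h1 : ((d + 2) / (d + 1) : ℝ) ≤ Real.exp (1 / (d + 1)) := by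
      refine le_trans (le_of_eq ?_) (Real.add_one_le_exp _)
      field_simp; ring
    have h2 : ((d + 2) / (d + 1) : ℝ) ^ (d + 1) ≤ Real.exp 1 := by
      refine (pow_le_pow_left₀ (by positivity) h1 _).trans (le_of_eq ?_)
      rw [← Real.exp_nat_mul]
      congr 1
      push_cast
      field_simp
    calc (1 : ℝ) = ((d + 2) / (d + 1) : ℝ) ^ (d + 1) * ((d + 1) / (d + 2) : ℝ) ^ (d + 1) := by
          rw [← mul_pow, div_mul_div_cancel₀ hd1.ne', div_self hd2.ne', one_pow]
      _ ≤ _ := mul_le_mul_of_nonneg_right h2 (by positivity)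
  have hkey : 1 ≤ Real.exp 1 * (d + 1) * (x * (1 - x) ^ d) := by
    refine hexp.trans (le_of_eq ?_)
    rw [hx', hx, pow_succ]
    field_simp
  have hp' : ∀ e, (#(A e) : ℝ) ≤ x * (1 - x) ^ d * Fintype.card (V → κ) := by
    intro e
    have hnn : 0 ≤ x * (1 - x) ^ d := mul_nonneg hx0 (pow_nonneg (by linarith) _)
    calc (#(A e) : ℝ) ≤ Real.exp 1 * (d + 1) * (x * (1 - x) ^ d) * #(A e) :=
          le_mul_of_one_le_left (Nat.cast_nonneg _) hkey
      _ = x * (1 - x) ^ d * (Real.exp 1 * (d + 1) * #(A e)) := by ring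
      _ ≤ _ := mul_le_mul_of_nonneg_left (hp e) hnn
  have h := pow_mul_card_avoiding_le A hx1.le ∅ univ
    (fun T _ e _ he => card_inter_avoiding_le N A hA hx0 hx1.le d hd hp' _ e he)
    (disjoint_empty_left _)
  have hall : avoiding A (∅ : Finset U) = univ := by simp [avoiding]
  rw [hall, empty_union] at h
  have hpos : (0 : ℝ) < (1 - x) ^ #(univ : Finset U) * #(univ : Finset (V → κ)) := by
    refine mul_pos (pow_pos (by linarith) _) ?_
    exact_mod_cast Fintype.card_pos (α := V → κ)
  obtain ⟨c, hc⟩ := card_pos.1 (by exact_mod_cast hpos.trans_le h :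
    0 < #(avoiding A (univ : Finset U)))
  simp only [avoiding, mem_filter, mem_univ, true_and, forall_const] at hc
  exact ⟨c, hc⟩

/-- The probability |κ|^(-#F) of a prescribed constant value on `F`, cleared of division. -/
theorem card_forall_eq_mul_pow (F : Finset V) (a : κ) :
    #(univ.filter fun c : V → κ => ∀ v ∈ F, c v = a) * Fintype.card κ ^ #F =
      Fintype.card (V → κ) := by
  have h : (univ.filter fun c : V → κ => ∀ v ∈ F, c v = a) =
      Fintype.piFinset fun v => if v ∈ F then {a} else univ := by
    ext c
    simp only [mem_filter, mem_univ, true_and, Fintype.mem_piFinset]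
    refine forall_congr' fun v => ?_
    by_cases hv : v ∈ F <;> simp [hv]
  rw [h, Fintype.card_piFinset, Fintype.card_fun, ← card_compl_add_card F, pow_add]
  congr 1
  rw [← Finset.prod_const, ← Finset.prod_compl_mul_prod F]
  rw [Finset.prod_congr rfl (g := fun _ => Fintype.card κ) fun v hv => by
      rw [if_neg (mem_compl.1 hv), card_univ],
    Finset.prod_congr (s₁ := F) rfl (g := fun _ => 1) fun v hv => by simp [hv]]
  simp

end LocalLemma

/-! ### Safe colorings and the fixing of good vertices and finished vertices -/

section

variable {V U : Type*} {H : Hypergraph V U} {α : ℝ} {δ d u : ℕ} {s g : PartialColoring V}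
  {B P T T' : Set U} {C : V → Color} {e f : U} {bb : BlackBox V U}

theorem Hypergraph.fixedMonochromatic_or_fixedBichromatic (H : Hypergraph V U)
    (s : PartialColoring V) (e : U) : H.FixedMonochromatic s e ∨ H.FixedBichromatic s e := by
  by_cases ht : ∃ v ∈ H.verts e, s v = some true
  · by_cases hf : ∃ v ∈ H.verts e, s v = some false
    · exact Or.inr ⟨ht, hf⟩
    · refine Or.inl ⟨true, fun v hv b hb => ?_⟩
      cases b
      · exact absurd ⟨v, hv, hb⟩ hf
      · rfl
  · refine Or.inl ⟨false, fun v hv b hb => ?_⟩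
    cases b
    · rfl
    · exact absurd ⟨v, hv, hb⟩ ht

theorem Hypergraph.FixedBichromatic.not_fixedMonochromatic (h : H.FixedBichromatic s e) :
    ¬ H.FixedMonochromatic s e := by
  rintro ⟨a, ha⟩
  obtain ⟨⟨v, hv, hv'⟩, w, hw, hw'⟩ := h
  have := (ha v hv _ hv').trans (ha w hw _ hw').symm
  simp at this

theorem Hypergraph.FixedBichromatic.mono (h : H.FixedBichromatic s e)
    (hsg : ∀ v a, s v = some a → g v = some a) : H.FixedBichromatic g e :=
  ⟨h.1.imp fun _ hv => ⟨hv.1, hsg _ _ hv.2⟩, h.2.imp fun _ hv => ⟨hv.1, hsg _ _ hv.2⟩⟩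

/-- Every hyperedge is bi-chromatic or has at least `α δ` undecided vertices. -/
def Hypergraph.Safe (H : Hypergraph V U) (α : ℝ) (δ : ℕ) (s : PartialColoring V) : Prop :=
  ∀ e, H.FixedBichromatic s e ∨ α * δ ≤ ((H.undecided s e).card : ℝ)

theorem Hypergraph.exists_undecided (hpos : 0 < α * δ)
    (h : α * δ ≤ ((H.undecided s e).card : ℝ)) : ∃ v ∈ H.verts e, s v = none := by
  classical
  have : 0 < (H.undecided s e).card := by exact_mod_cast hpos.trans_le h
  obtain ⟨v, hv⟩ := Finset.card_pos.1 this
  exact ⟨v, by simpa [Hypergraph.undecided] using hv⟩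

/-- Positivity of αδ excludes a fully decided monochromatic hyperedge, which would be idle without
being bi-chromatic. -/
theorem Hypergraph.Safe.nonIdle (hs : H.Safe α δ s) (hpos : 0 < α * δ)
    (h : ¬ H.FixedBichromatic s e) : H.NonIdle s e :=
  ⟨(H.fixedMonochromatic_or_fixedBichromatic s e).resolve_right h,
    exists_undecided hpos ((hs e).resolve_left h)⟩

theorem Hypergraph.fixGood_eq_some {v : V} {a : Color} (h : s v = some a) :
    H.fixGood B C s v = some a := by
  simp [Hypergraph.fixGood, h]

theorem Hypergraph.recolor_eq_some {v : V} {a : Color} (h : g v = some a) :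
    H.recolor α δ u bb P B g v = some a := by
  simp [Hypergraph.recolor, h]

theorem Hypergraph.fixFinished_eq_some {v : V} {a : Color} (h : g v = some a) :
    H.fixFinished C g v = some a := by
  simp [Hypergraph.fixFinished, h]

theorem Hypergraph.fixGood_eq_none {v : V} (h : H.fixGood B C s v = none) :
    s v = none ∧ v ∈ H.covered B := by
  unfold Hypergraph.fixGood at h
  split_ifs at h with h1
  exact ⟨h, by tauto⟩

theorem Hypergraph.currentColor_of_fixGood {v : V} {a : Color}
    (h : H.fixGood B C s v = some a) : currentColor s C v = a := by
  unfold Hypergraph.fixGood at h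
  split_ifs at h with h1
  · simpa [currentColor, h1.1] using h
  · simp [currentColor, h]

/-- A biased hyperedge consists of bad vertices only, so it loses no undecided vertex. A non-biased
one has more than αδ vertices of each current color; if only color `a` gets fixed, those of the
other color are all still undecided. -/
theorem Hypergraph.Safe.fixGood (hs : H.Safe α δ s) (hpos : 0 < α * δ)
    (hP : {e | H.NonIdle s e} ⊆ P) :
    H.Safe α δ (H.fixGood (H.biasedSet α δ P s C) C s) := by
  classical
  intro e
  by_cases hbi : H.FixedBichromatic s e
  · exact Or.inl (hbi.mono fun _ _ => fixGood_eq_some)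
  have heP : e ∈ P := hP (hs.nonIdle hpos hbi)
  by_cases hB : e ∈ H.biasedSet α δ P s C
  · refine Or.inr (((hs e).resolve_left hbi).trans ?_)
    refine Nat.cast_le.2 (Finset.card_le_card fun v hv => ?_)
    simp only [undecided, Finset.mem_filter] at hv ⊢
    refine ⟨hv.1, ?_⟩
    have : v ∈ H.covered (H.biasedSet α δ P s C) := ⟨e, hB, hv.1⟩
    simp [Hypergraph.fixGood, hv.2, this]
  · refine (H.fixedMonochromatic_or_fixedBichromatic _ e).symm.imp id ?_
    rintro ⟨a, ha⟩
    have hnb : ¬ H.Biased α δ (currentColor s C) e := fun h => hB ⟨heP, h⟩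
    simp only [Biased, not_exists, not_le] at hnb
    refine (hnb (!a)).le.trans (Nat.cast_le.2 (Finset.card_le_card fun v hv => ?_))
    simp only [undecided, Finset.mem_filter] at hv ⊢
    refine ⟨hv.1, Option.eq_none_iff_forall_ne_some.2 fun b hb => ?_⟩
    have h1 := ha v hv.1 b hb
    rw [currentColor_of_fixGood hb, h1] at hv
    simp at hv

theorem Hypergraph.Safe.fixFinished (hg : H.Safe α δ g) : H.Safe α δ (H.fixFinished C g) := by
  classical
  intro e
  by_cases hbi : H.FixedBichromatic g e
  · exact Or.inl (hbi.mono fun _ _ => fixFinished_eq_some)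
  refine Or.inr (((hg e).resolve_left hbi).trans ?_)
  refine Nat.cast_le.2 (Finset.card_le_card fun v hv => ?_)
  simp only [undecided, Finset.mem_filter] at hv ⊢
  refine ⟨hv.1, ?_⟩
  have : ¬ ∀ e, v ∈ H.verts e → H.FixedBichromatic g e := fun h => hbi (h e hv.1)
  simp [Hypergraph.fixFinished, hv.2, this]

/-! ### Maximal connected 1,2-components -/

/-- An admissible walk between `T` and `T'` makes `T ∪ T'` connected, and maximality of `T` absorbs
`T'`. -/
theorem Hypergraph.IsComponent12.subset_of_walk (hT : H.IsComponent12 B T) (hB : T' ⊆ B)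
    (hT' : H.Connected12 T') (he : e ∈ T) (hf : f ∈ T') (p : H.intersectionGraph.Walk e f)
    (hp : ∀ a ∈ p.darts, a.fst ∈ T ∪ T' ∨ a.snd ∈ T ∪ T') : T' ⊆ T := by
  classical
  have key : ∀ x ∈ T, ∀ y ∈ T', ∃ q : H.intersectionGraph.Walk x y,
      ∀ a ∈ q.darts, a.fst ∈ T ∪ T' ∨ a.snd ∈ T ∪ T' := by
    intro x hx y hy
    obtain ⟨q₁, -, hq₁⟩ := hT.prop.2.2 x hx e he
    obtain ⟨q₂, -, hq₂⟩ := hT' f hf y hy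
    refine ⟨(q₁.append p).append q₂, fun a ha => ?_⟩
    simp only [SimpleGraph.Walk.darts_append, List.mem_append] at ha
    rcases ha with (ha | ha) | ha
    · exact (hq₁ a ha).imp Or.inl Or.inl
    · exact hp a ha
    · exact (hq₂ a ha).imp Or.inr Or.inr
  have hcon : H.Connected12 (T ∪ T') := by
    intro x hx y hy
    suffices ∃ q : H.intersectionGraph.Walk x y,
        ∀ a ∈ q.darts, a.fst ∈ T ∪ T' ∨ a.snd ∈ T ∪ T' by
      obtain ⟨q, hq⟩ := this
      exact ⟨q.bypass, q.bypass_isPath, fun a ha => hq a (q.darts_bypass_subset_darts ha)⟩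
    rcases hx with hx | hx <;> rcases hy with hy | hy
    · obtain ⟨q, -, hq⟩ := hT.prop.2.2 x hx y hy
      exact ⟨q, fun a ha => (hq a ha).imp Or.inl Or.inl⟩
    · exact key x hx y hy
    · obtain ⟨q, hq⟩ := key y hy x hx
      refine ⟨q.reverse, fun a ha => ?_⟩
      have := hq a.symm (by simpa using ha)
      exact this.symm
    · obtain ⟨q, -, hq⟩ := hT' x hx y hy
      exact ⟨q, fun a ha => (hq a ha).imp Or.inr Or.inr⟩
  exact fun y hy => hT.le_of_ge
    ⟨hT.prop.1.inl, Set.union_subset hT.prop.2.1 hB, hcon⟩ Set.subset_union_left (Or.inr hy)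

theorem Hypergraph.connected12_singleton (H : Hypergraph V U) (f : U) : H.Connected12 {f} := by
  rintro x rfl y rfl
  exact ⟨.nil, by simp, by simp⟩

theorem Hypergraph.IsComponent12.mem_of_adj (hT : H.IsComponent12 B T) (he : e ∈ T)
    (hf : f ∈ B) {v : V} (hve : v ∈ H.verts e) (hvf : v ∈ H.verts f) : f ∈ T := by
  by_cases hef : e = f
  · exact hef ▸ he
  have hadj : H.intersectionGraph.Adj e f := ⟨hef, v, hve, hvf⟩
  refine hT.subset_of_walk (Set.singleton_subset_iff.2 hf) (H.connected12_singleton f) he rfl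
    (.cons hadj .nil) (fun a ha => ?_) rfl
  simp only [SimpleGraph.Walk.darts_cons, SimpleGraph.Walk.darts_nil, List.mem_singleton] at ha
  subst ha
  exact Or.inl (Or.inl he)

/-- The middle hyperedge `f` need not be biased, since each of the two edges has an end in `T` or
equal to `k`. Thus the biased neighbors of a hyperedge meeting `T` all belong to `T`. -/
theorem Hypergraph.IsComponent12.mem_of_adj_adj (hT : H.IsComponent12 B T) (he : e ∈ T)
    {k : U} (hk : k ∈ B) (hef : H.intersectionGraph.Adj e f)
    (hfk : H.intersectionGraph.Adj f k) : k ∈ T := by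
  refine hT.subset_of_walk (Set.singleton_subset_iff.2 hk) (H.connected12_singleton k) he rfl
    (.cons hef (.cons hfk .nil)) (fun a ha => ?_) rfl
  simp only [SimpleGraph.Walk.darts_cons, SimpleGraph.Walk.darts_nil, List.mem_cons,
    List.not_mem_nil, or_false] at ha
  rcases ha with rfl | rfl
  · exact Or.inl (Or.inl he)
  · exact Or.inr (Or.inr rfl)

/-- Makes the component chosen in `recolor` for a vertex independent of the choice. -/
theorem Hypergraph.IsComponent12.eq_of_mem_covered (hT : H.IsComponent12 B T)
    (hT' : H.IsComponent12 B T') {v : V} (hv : v ∈ H.covered T) (hv' : v ∈ H.covered T') :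
    T = T' := by
  obtain ⟨e, he, hve⟩ := hv
  obtain ⟨f, hf, hvf⟩ := hv'
  have hf' := hT.mem_of_adj he (hT'.prop.2.1 hf) hve hvf
  exact (hT'.subset_of_walk hT.prop.2.1 hT.prop.2.2 hf hf' .nil (by simp)).antisymm
    (hT.subset_of_walk hT'.prop.2.1 hT'.prop.2.2 hf' hf .nil (by simp))

/-! ### Solvable Black-Box instances and the recoloring step -/

/-- A safe partial coloring extends to a coloring that makes every hyperedge bi-chromatic. -/
theorem Hypergraph.Safe.exists_solves [Fintype V] [Fintype U] (hg : H.Safe α δ g)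
    (hd : H.IntersectsAtMost d)
    (hδ : 2 * Real.exp 1 * ((d : ℝ) + 1) ≤ (2 : ℝ) ^ (α * (δ : ℝ))) (F : Set U) :
    ∃ c, H.Solves g F c := by
  classical
  let mono : U → Color → Finset (V → Color) := fun e a =>
    Finset.univ.filter fun c => ∀ v ∈ H.verts e, currentColor g c v = a
  obtain ⟨c, hc⟩ := exists_forall_notMem_of_local H.verts
    (fun e => mono e true ∪ mono e false) (by
      intro e c c' hcc hc
      have h : ∀ v ∈ H.verts e, currentColor g c v = currentColor g c' v := fun v hv => by
        simp [currentColor, hcc v hv]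
      simp only [mono, Finset.mem_union, Finset.mem_filter, Finset.mem_univ, true_and] at hc ⊢
      exact hc.imp (fun h' v hv => h v hv ▸ h' v hv) (fun h' v hv => h v hv ▸ h' v hv)) d (by
      intro e S hS
      have h1 : (S : Set U) ⊆ {f | H.intersectionGraph.Adj e f} := by
        intro f hf
        obtain ⟨hne, hdis⟩ := hS f hf
        obtain ⟨v, hv, hv'⟩ := Finset.not_disjoint_iff.1 hdis
        exact ⟨hne.symm, v, hv, hv'⟩
      have h2 := (Set.encard_le_encard h1).trans (hd e)
      rw [Set.encard_coe_eq_coe_finsetCard] at h2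
      exact_mod_cast h2) (by
      intro e
      rcases hg e with hbi | hund
      -- A hyperedge with both fixed colors cannot become monochromatic, so its event is empty.
      · have hempty : ∀ a, mono e a = ∅ := by
          intro a
          refine Finset.filter_eq_empty_iff.2 fun c _ h => hbi.not_fixedMonochromatic
            ⟨a, fun v hv b hb => ?_⟩
          have := h v hv
          simpa [currentColor, hb] using this
        simp [hempty]
      · set m := (H.undecided g e).card with hm
        have h1 : ∀ a, ((mono e a).card : ℝ) * 2 ^ m ≤ Fintype.card (V → Color) := by
          intro a
          have h2 := card_forall_eq_mul_pow (H.undecided g e) a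
          have h3 : (mono e a).card * 2 ^ m ≤ Fintype.card (V → Color) := by
            rw [← h2, ← hm, Fintype.card_bool]
            refine Nat.mul_le_mul_right _ (Finset.card_le_card fun c hc => ?_)
            simp only [mono, Finset.mem_filter, Finset.mem_univ, true_and] at hc ⊢
            intro v hv
            simp only [undecided, Finset.mem_filter] at hv
            have := hc v hv.1
            simpa [currentColor, hv.2] using this
          exact_mod_cast h3
        -- The factor 2 pays for the union bound over the two colors.
        have h4 : 2 * Real.exp 1 * ((d : ℝ) + 1) ≤ 2 ^ m := by
          refine hδ.trans ?_
          rw [← Real.rpow_natCast]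
          exact Real.rpow_le_rpow_of_exponent_le (by norm_num) hund
        have h5 : ((mono e true ∪ mono e false).card : ℝ) ≤
            (mono e true).card + (mono e false).card := by
          exact_mod_cast Finset.card_union_le _ _
        have h6 : (0 : ℝ) ≤ (mono e true ∪ mono e false).card := Nat.cast_nonneg _
        have h7 : (0 : ℝ) < 2 ^ m := by positivity
        have := mul_le_mul_of_nonneg_right h4 h6
        have := mul_le_mul_of_nonneg_right h5 h7.le
        linarith [h1 true, h1 false])
  refine ⟨currentColor g c, fun v a h => by simp [currentColor, h], fun e _ => ?_⟩
  have h := hc e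
  simp only [mono, Finset.mem_union, Finset.mem_filter, Finset.mem_univ, true_and, not_or,
    not_forall] at h
  obtain ⟨⟨v, hv, hv'⟩, w, hw, hw'⟩ := h
  exact ⟨⟨w, hw, by simpa using hw'⟩, v, hv, by simpa using hv'⟩

/-- A hyperedge not yet bi-chromatic either has no undecided vertex in a small component and is left
alone, or meets such a component `T`. In the second case it belongs to the Black-Box instance of `T`
and agrees with that solution on all its vertices. -/
theorem Hypergraph.Safe.recolor [Fintype V] [Fintype U] (hs : H.Safe α δ s)
    (hpos : 0 < α * δ) (hP : {e | H.NonIdle s e} ⊆ P)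
    (hg : H.Safe α δ (H.fixGood B C s)) (hd : H.IntersectsAtMost d)
    (hδ : 2 * Real.exp 1 * ((d : ℝ) + 1) ≤ (2 : ℝ) ^ (α * (δ : ℝ))) (hbb : bb.Correct) :
    H.Safe α δ (H.recolor α δ u bb P B (H.fixGood B C s)) := by
  classical
  set g := H.fixGood B C s with hgdef
  intro e
  by_cases hbi : H.FixedBichromatic g e
  · exact Or.inl (hbi.mono fun _ _ => recolor_eq_some)
  have hund := (hg e).resolve_left hbi
  have hbad : ∀ v, g v = none → v ∈ H.covered B := fun v hv => (fixGood_eq_none hv).2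
  by_cases hex : ∃ v ∈ H.verts e, ∃ T, H.IsComponent12 B T ∧ H.SmallDiameter u T ∧
      v ∈ H.covered T ∧ g v = none
  swap
  · refine Or.inr (hund.trans ?_)
    refine Nat.cast_le.2 (Finset.card_le_card fun v hv => ?_)
    simp only [undecided, Finset.mem_filter] at hv ⊢
    refine ⟨hv.1, ?_⟩
    unfold Hypergraph.recolor
    rw [dif_neg]
    · exact hv.2
    · rintro ⟨_, T, h1, h2, h3⟩
      exact hex ⟨v, hv.1, T, h1, h2, h3, hv.2⟩
  obtain ⟨v, hve, T, hT, hsmall, ⟨f, hfT, hvf⟩, -⟩ := hex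
  have heP : e ∈ P := hP (hs.nonIdle hpos fun h => hbi (h.mono fun _ _ => fixGood_eq_some))
  -- If `e` is biased, it lies in `T` itself; otherwise `e` links `f` in `T` to the biased hyperedge
  -- `k` at `w`, which puts `k` into `T`.
  have hcov : ∀ w ∈ H.verts e, g w = none → w ∈ H.covered T := by
    intro w hw hgw
    obtain ⟨k, hkB, hwk⟩ := hbad w hgw
    by_cases heB : e ∈ B
    · exact ⟨e, hT.mem_of_adj hfT heB hvf hve, hw⟩
    · exact ⟨k, hT.mem_of_adj_adj (f := e) hfT hkB
        ⟨fun h => heB (h ▸ hT.prop.2.1 hfT), v, hvf, hve⟩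
        ⟨fun h => heB (h ▸ hkB), w, hw, hwk⟩, hwk⟩
  have heF : e ∈ H.withDangerous α δ P B T := by
    by_cases heB : e ∈ B
    · exact Or.inl (hT.mem_of_adj hfT heB hvf hve)
    · refine Or.inr ⟨heP, heB, ?_, f, hfT, fun h => heB (h ▸ hT.prop.2.1 hfT), v, hve, hvf⟩
      -- After the good vertices are fixed, every undecided vertex is bad, so αδ undecided vertices
      -- make `e` dangerous.
      refine hund.trans (Nat.cast_le.2 (Finset.card_le_card fun w hw => ?_))
      simp only [undecided, Finset.mem_filter] at hw ⊢
      exact ⟨hw.1, hbad w hw.2⟩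
  have hsol := hbb H g (H.withDangerous α δ P B T) (hg.exists_solves hd hδ _)
  have hval : ∀ w ∈ H.verts e, H.recolor α δ u bb P B g w =
      some (bb H g (H.withDangerous α δ P B T) w) := by
    intro w hw
    cases hgw : g w with
    | some a => rw [recolor_eq_some hgw, hsol.1 w a hgw]
    | none =>
      have h : g w = none ∧ ∃ T, H.IsComponent12 B T ∧ H.SmallDiameter u T ∧ w ∈ H.covered T :=
        ⟨hgw, T, hT, hsmall, hcov w hw hgw⟩
      unfold Hypergraph.recolor
      rw [dif_pos h, h.2.choose_spec.1.eq_of_mem_covered hT h.2.choose_spec.2.2 (hcov w hw hgw)]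
  obtain ⟨⟨w, hw, hw'⟩, w₂, hw₂, hw₂'⟩ := hsol.2 e heF
  exact Or.inl ⟨⟨w, hw, by rw [hval w hw, hw']⟩, w₂, hw₂, by rw [hval w₂ hw₂, hw₂']⟩

theorem Hypergraph.Safe.phase [Fintype V] [Fintype U] (hs : H.Safe α δ s) (hpos : 0 < α * δ)
    (hP : {e | H.NonIdle s e} ⊆ P) (hd : H.IntersectsAtMost d)
    (hδ : 2 * Real.exp 1 * ((d : ℝ) + 1) ≤ (2 : ℝ) ^ (α * (δ : ℝ))) (hbb : bb.Correct) :
    H.Safe α δ (H.phase α δ u bb C P s) :=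
  (hs.recolor hpos hP (hs.fixGood hpos hP) hd hδ hbb).fixFinished

theorem Hypergraph.phase_eq_some {v : V} {a : Color} (h : s v = some a) :
    H.phase α δ u bb C P s v = some a :=
  fixFinished_eq_some (recolor_eq_some (fixGood_eq_some h))

end

end LocalHyp

/-! ### Induction over the phases -/

theorem mainTheorem4 {V U : Type*} [Fintype V] [Fintype U]
    (n δ d u x : ℕ) (α : ℝ) (hα0 : 0 < α) (hα1 : α < 1 / 2) (hu : 2 < u)
    (H : LocalHyp.Hypergraph V U) (hH : H.Admissible n δ)
    (hd : H.IntersectsAtMost d)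
    (hδ : 2 * Real.exp 1 * ((d : ℝ) + 1) ≤ (2 : ℝ) ^ (α * (δ : ℝ)))
    (bb : LocalHyp.BlackBox V U) (hbb : bb.Correct)
    (C : ℕ → V → LocalHyp.Color) (S : ℕ → LocalHyp.PartialColoring V)
    (hS : H.IsExecution α δ u bb x C S) :
    (∀ i ≤ x, ∀ e, H.NonIdle (S i) e →
      H.FixedMonochromatic (S i) e ∧ α * (δ : ℝ) ≤ ((H.undecided (S i) e).card : ℝ)) ∧
    (∀ i j, i ≤ j → j ≤ x → ∀ e, ¬ H.NonIdle (S i) e →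
      ¬ H.NonIdle (S j) e ∧ H.FixedBichromatic (S j) e) := by
  have hpos : 0 < α * δ := by
    refine mul_pos hα0 (Nat.cast_pos.2 (Nat.pos_of_ne_zero ?_))
    -- For `δ = 0` the hypothesis `hδ` would read 2e(d+1) ≤ 1.
    rintro rfl
    have h1 : (1 : ℝ) ≤ Real.exp 1 := Real.one_le_exp (by norm_num)
    simp only [Nat.cast_zero, mul_zero, Real.rpow_zero] at hδ
    nlinarith [Nat.cast_nonneg (α := ℝ) d]
  have hsafe : ∀ i ≤ x, H.Safe α δ (S i) := by
    intro i
    induction i with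
    | zero =>
      intro _ e
      right
      have h : H.undecided (S 0) e = H.verts e :=
        Finset.filter_true_of_mem fun v _ => hS.init v
      rw [h, hH.2.2 e]
      -- Initially all δ ≥ αδ vertices are undecided.
      exact mul_le_of_le_one_left (Nat.cast_nonneg _) (by linarith)
    | succ i ih =>
      intro hi
      obtain ⟨P, hP, hstep⟩ := hS.step i hi
      rw [hstep]
      exact (ih (Nat.le_of_succ_le hi)).phase hpos hP hd hδ hbb
  have hmono : ∀ i j, i ≤ j → j ≤ x → ∀ v a, S i v = some a → S j v = some a := by
    intro i j hij
    induction j, hij using Nat.le_induction with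
    | base => exact fun _ _ _ h => h
    | succ j _ ih =>
      intro hj v a h
      obtain ⟨P, -, hstep⟩ := hS.step j hj
      rw [hstep]
      exact LocalHyp.Hypergraph.phase_eq_some (ih (Nat.le_of_succ_le hj) v a h)
  refine ⟨fun i hi e he => ⟨he.1, (hsafe i hi e).resolve_left fun h =>
    h.not_fixedMonochromatic he.1⟩, fun i j hij hj e he => ?_⟩
  have hbi : H.FixedBichromatic (S i) e := by
    by_contra h
    exact he ((hsafe i (hij.trans hj)).nonIdle hpos h)
  have hbj := hbi.mono (hmono i j hij hj)
  exact ⟨fun h => hbj.not_fixedMonochromatic h.1, hbj⟩
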